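/- Let $\mathscr H,\mathscr K$ be complex Hilbert spaces, let $0<m<M$, and let $A,B$ be positive invertible bounded operators on $\mathscr H$ with spectra $\mathrm{Sp}(A),\mathrm{Sp}(B)\subseteq[m,M]$. Let $\Phi:\mathcal B(\mathscr H)\to\mathcal B(\mathscr K)$ be a unital positive linear map. Put $h=M/m$, and for $p\ne 0,1$ let $$K(h,p)=\frac{h^p-h}{(p-1)(h-1)}\left(\frac{p-1}{p}\,\frac{h^p-1}{h^p-h}\right)^p$$ be the generalized Kantorovich constant, with $K(h,0)=K(h,1)=1$ (the limit values). Powers of operators are defined by the continuous functional calculus, and $\le$ is the Löwner order. Then: (i) for all $p\ge 1$, $$K(h,p)^{-\frac1p}\left[\Phi(A^p)^{\frac1p}+\Phi(B^p)^{\frac1p}\right]\le\Phi((A+B)^p)^{\frac1p}\le K(h,p)^{\frac1p}\left[\Phi(A^p)^{\frac1p}+\Phi(B^p)^{\frac1p}\right];$$ (ii) for all $p\le -1$ and all $\frac12\le p\le 1$, $$K(h,p)^{\frac1p}\left[\Phi(A^p)^{\frac1p}+\Phi(B^p)^{\frac1p}\right]\le\Phi((A+B)^p)^{\frac1p}\le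 K(h,p)^{-\frac1p}\left[\Phi(A^p)^{\frac1p}+\Phi(B^p)^{\frac1p}\right];$$ (iii) for all $-1<p<0$ and all $0<p<\frac12$, $$K(h,p)^{\frac2p}\left[\Phi(A^p)^{\frac1p}+\Phi(B^p)^{\frac1p}\right]\le\Phi((A+B)^p)^{\frac1p}\le K(h,p)^{-\frac2p}\left[\Phi(A^p)^{\frac1p}+\Phi(B^p)^{\frac1p}\right].$$ -/

import Mathlib

/-- The generalized Kantorovich constant `K(h, p)` for `h > 0` and real `p`. At the removable
singularities `p = 0`, `p = 1` and `h = 1` of the defining formula it has the limit value `1`. -/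
noncomputable def kantorovich (h p : ℝ) : ℝ :=
  if h = 1 ∨ p = 0 ∨ p = 1 then 1
  else (h ^ p - h) / ((p - 1) * (h - 1)) * ((p - 1) / p * ((h ^ p - 1) / (h ^ p - h))) ^ p

/-! For each operator `X` among `A`, `B`, `A + B`, compare the power mean `Φ (X ^ p) ^ (1 / p)` with
`Φ X`, which is additive in `X`. Since `A + B` has spectrum in [2m, 2M], the ratio M/m, and hence
the constant, is the same for all three.

One kind of comparison is operator Jensen for t ↦ t^(1/p), with constant 1: concave for p ≥ 1,
convex for 1/p in [-1, 0) or [1, 2]. It rests on 2-positivity of positive maps on commutative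
algebras, which yields Choi's inequality, then exponents in [0, 1] by an integral of resolvents,
then the convex ranges by reflecting exponents.

The other kind costs C = K^(-1/p) and needs only scalar calculus: on [m, M] the function s lies
between an affine function of s^p and a multiple of it. Combining the two kinds gives (i) and (ii);
in (iii) Jensen is not available, so the Kantorovich comparison is used twice, which squares C. -/

open scoped unitInterval

/-! ### 2-positivity on commutative algebras -/

section BlockPositivity

variable {A₁ A₂ : Type*} [CStarAlgebra A₁] [CStarAlgebra A₂] [PartialOrder A₁] [PartialOrder A₂]

theorem PositiveLinearMap.map_algebraMap_real (Φ : A₁ →ₚ[ℂ] A₂) (hΦ : Φ 1 = 1) (r : ℝ) :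
    Φ (algebraMap ℝ A₁ r) = algebraMap ℝ A₂ r := by
  rw [Algebra.algebraMap_eq_smul_one, Algebra.algebraMap_eq_smul_one, ← Complex.coe_smul,
    map_smul, hΦ, Complex.coe_smul]

theorem PositiveLinearMap.map_real_smul (Φ : A₁ →ₚ[ℂ] A₂) (r : ℝ) (X : A₁) :
    Φ (r • X) = r • Φ X := by
  rw [← Complex.coe_smul, map_smul, Complex.coe_smul]

variable [StarOrderedRing A₁] [StarOrderedRing A₂]

/-- Positive maps on `C(I, ℝ)` are 2-positive, tested on the vector `(c, -1)`. -/
theorem nonneg_block_of_nonneg_unitInterval (Ψ : C(I, ℝ) →L[ℝ] A₂)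
    (hΨ : ∀ f, 0 ≤ f → 0 ≤ Ψ f) (u v : C(I, ℝ)) {c : A₂} (hc : IsSelfAdjoint c) :
    0 ≤ c * Ψ (u * u) * c - c * Ψ (u * v) - Ψ (u * v) * c + Ψ (v * v) := by
  have hlim (f : C(I, ℝ)) : Filter.Tendsto (fun n => Ψ (bernsteinApproximation n f))
      Filter.atTop (nhds (Ψ f)) :=
    (Ψ.continuous.tendsto f).comp (bernsteinApproximation_uniform f)
  have happrox (n : ℕ) (f : C(I, ℝ)) : Ψ (bernsteinApproximation n f) =
      ∑ k : Fin (n + 1), f (bernstein.z k) • Ψ (bernstein n k) := by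
    have : bernsteinApproximation n f =
        ∑ k : Fin (n + 1), f (bernstein.z k) • bernstein n k := by
      ext x
      simp [bernsteinApproximation.apply, mul_comm]
    rw [this]
    simp
  refine ge_of_tendsto' ((((((hlim (u * u)).const_mul c).mul_const c).sub
    ((hlim (u * v)).const_mul c)).sub ((hlim (u * v)).mul_const c)).add (hlim (v * v)))
    fun n => ?_
  -- The Bernstein polynomials are nonnegative and the approximants only sample `u` and `v` at
  -- nodes, so the approximated block is a sum of these conjugates of `Ψ (bernstein n k) ≥ 0`.
  have hsq (k : Fin (n + 1)) : 0 ≤ (u (bernstein.z k) • c - v (bernstein.z k) • (1 : A₂)) *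
      Ψ (bernstein n k) * (u (bernstein.z k) • c - v (bernstein.z k) • (1 : A₂)) := by
    have hs : IsSelfAdjoint (u (bernstein.z k) • c - v (bernstein.z k) • (1 : A₂)) :=
      ((IsSelfAdjoint.all _).smul hc).sub ((IsSelfAdjoint.all _).smul (.one _))
    simpa [hs.star_eq] using star_left_conjugate_nonneg
      (hΨ (bernstein n k) fun x => bernstein_nonneg) (u (bernstein.z k) • c - v (bernstein.z k) • 1)
  refine (Finset.sum_nonneg fun k (_ : k ∈ Finset.univ) => hsq k).trans_eq ?_
  simp only [happrox, Finset.mul_sum, Finset.sum_mul, ← Finset.sum_sub_distrib,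
    ← Finset.sum_add_distrib]
  refine Finset.sum_congr rfl fun k _ => ?_
  simp only [ContinuousMap.mul_apply, sub_mul, mul_sub, smul_mul_assoc, mul_smul_comm, one_mul,
    mul_one, smul_smul, smul_sub]
  rw [mul_comm (v _) (u _)]
  abel

/-- A positive map is 2-positive on the commutative algebra generated by a self-adjoint element,
tested on the vector `(c, -1)`. -/
theorem PositiveLinearMap.nonneg_block_cfc (Φ : A₁ →ₚ[ℂ] A₂) {X : A₁} (hX : IsSelfAdjoint X)
    {a b : ℝ} (hab : a < b) (hspec : spectrum ℝ X ⊆ Set.Icc a b) {u v : ℝ → ℝ}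
    (hu : ContinuousOn u (Set.Icc a b)) (hv : ContinuousOn v (Set.Icc a b))
    {c : A₂} (hc : IsSelfAdjoint c) :
    0 ≤ c * Φ (cfc (fun x => u x * u x) X) * c - c * Φ (cfc (fun x => u x * v x) X)
      - Φ (cfc (fun x => u x * v x) X) * c + Φ (cfc (fun x => v x * v x) X) := by
  have hba : 0 < b - a := sub_pos.2 hab
  let w : I → ℝ := fun t => a + (b - a) * t
  have hw : Continuous w := by fun_prop
  have hwmem (t : I) : w t ∈ Set.Icc a b := by
    have h0 := mul_nonneg hba.le t.2.1
    have h1 := mul_nonneg hba.le (sub_nonneg.2 t.2.2)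
    constructor <;> simp only [w] <;> linarith
  let lift (f : ℝ → ℝ) (hf : ContinuousOn f (Set.Icc a b)) : C(I, ℝ) :=
    ⟨fun t => f (w t), hf.comp_continuous hw hwmem⟩
  -- `ρ` inverts the parametrization `w` of [a, b] on the spectrum, so composing with it transports
  -- the calculus of `X` to C(I, ℝ).
  let ρ : C(spectrum ℝ X, I) :=
    ⟨fun x => ⟨(x - a) / (b - a), div_nonneg (sub_nonneg.2 (hspec x.2).1) hba.le,
      (div_le_one hba).2 (sub_le_sub_right (hspec x.2).2 a)⟩, by fun_prop⟩
  have hρ (x : spectrum ℝ X) : w (ρ x) = x := by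
    simp only [w, ρ, ContinuousMap.coe_mk]
    field_simp
    ring
  have hΦc : Continuous Φ := map_continuous Φ
  let Ψ : C(I, ℝ) →L[ℝ] A₂ :=
    { toFun := fun f => Φ (cfcHom hX (f.comp ρ))
      map_add' := fun f g => by rw [ContinuousMap.add_comp, map_add, map_add]
      map_smul' := fun r f => by
        rw [ContinuousMap.smul_comp, map_smul, ← Complex.coe_smul, map_smul]
        simp
      cont := hΦc.comp ((cfcHom_continuous hX).comp (ContinuousMap.continuous_precomp ρ)) }
  have hΨ (f : ℝ → ℝ) (hf : ContinuousOn f (Set.Icc a b)) : Ψ (lift f hf) = Φ (cfc f X) := by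
    rw [cfc_apply f X hX (hf.mono hspec)]
    change Φ _ = Φ _
    congr 2
    ext x
    simp [lift, hρ]
  have key := nonneg_block_of_nonneg_unitInterval Ψ (fun f hf => map_nonneg Φ
    (cfcHom_nonneg_iff hX |>.2 fun x => hf (ρ x))) (lift u hu) (lift v hv) hc
  have huu : lift u hu * lift u hu = lift _ (hu.mul hu) := rfl
  have huv : lift u hu * lift v hv = lift _ (hu.mul hv) := rfl
  have hvv : lift v hv * lift v hv = lift _ (hv.mul hv) := rfl
  rwa [huu, huv, hvv, hΨ _ (hu.mul hu), hΨ _ (hu.mul hv), hΨ _ (hv.mul hv)] at key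

theorem exists_spectrum_subset_Icc_of_isStrictlyPositive {X : A₁} (hX : IsStrictlyPositive X) :
    ∃ a b : ℝ, 0 < a ∧ a < b ∧ spectrum ℝ X ⊆ Set.Icc a b := by
  rcases subsingleton_or_nontrivial A₁ with _ | _
  · exact ⟨1, 2, one_pos, one_lt_two, by simp [spectrum.of_subsingleton]⟩
  obtain ⟨a, ha, haX⟩ := (CFC.exists_pos_algebraMap_le_iff (a := X) hX.isSelfAdjoint).2
    fun x hx => (StarOrderedRing.isStrictlyPositive_iff_spectrum_pos X).1 hX x hx
  -- The `+ 1` makes the interval nondegenerate, as rescaling to `I` requires.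
  refine ⟨a, a + ‖X‖ + 1, ha, by linarith [norm_nonneg X], fun x hx =>
    ⟨(algebraMap_le_iff_le_spectrum (a := X) hX.isSelfAdjoint).1 haX x hx, ?_⟩⟩
  have := spectrum.norm_le_norm_of_mem hx
  rw [Real.norm_eq_abs] at this
  linarith [le_abs_self x]

theorem PositiveLinearMap.isSelfAdjoint_map (Φ : A₁ →ₚ[ℂ] A₂) {X : A₁} (hX : IsSelfAdjoint X) :
    IsSelfAdjoint (Φ X) :=
  hX.map Φ

theorem PositiveLinearMap.spectrum_map_subset_Icc (Φ : A₁ →ₚ[ℂ] A₂) (hΦ : Φ 1 = 1) {X : A₁}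
    (hX : IsSelfAdjoint X) {a b : ℝ} (h : spectrum ℝ X ⊆ Set.Icc a b) :
    spectrum ℝ (Φ X) ⊆ Set.Icc a b := by
  have h1 := (algebraMap_le_iff_le_spectrum (a := X) hX).2 fun x hx => (h hx).1
  have h2 := (le_algebraMap_iff_spectrum_le (a := X) hX).2 fun x hx => (h hx).2
  replace h1 := OrderHomClass.mono Φ h1
  replace h2 := OrderHomClass.mono Φ h2
  rw [Φ.map_algebraMap_real hΦ] at h1 h2
  exact fun x hx => ⟨(algebraMap_le_iff_le_spectrum (Φ.isSelfAdjoint_map hX)).1 h1 x hx,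
    (le_algebraMap_iff_spectrum_le (Φ.isSelfAdjoint_map hX)).1 h2 x hx⟩

theorem PositiveLinearMap.isStrictlyPositive_map (Φ : A₁ →ₚ[ℂ] A₂) (hΦ : Φ 1 = 1) {X : A₁}
    (hX : IsStrictlyPositive X) : IsStrictlyPositive (Φ X) := by
  obtain ⟨a, b, ha, -, hspec⟩ := exists_spectrum_subset_Icc_of_isStrictlyPositive hX
  exact (StarOrderedRing.isStrictlyPositive_iff_spectrum_pos _
    (Φ.isSelfAdjoint_map hX.isSelfAdjoint)).2 fun x hx =>
    ha.trans_le (Φ.spectrum_map_subset_Icc hΦ hX.isSelfAdjoint hspec hx).1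

theorem PositiveLinearMap.nonneg_block_rpow (Φ : A₁ →ₚ[ℂ] A₂) {X : A₁}
    (hX : IsStrictlyPositive X) (s e : ℝ) {c : A₂} (hc : IsSelfAdjoint c) :
    0 ≤ c * Φ (X ^ s) * c - c * Φ (X ^ e) - Φ (X ^ e) * c + Φ (X ^ (2 * e - s)) := by
  obtain ⟨a, b, ha, hab, hspec⟩ := exists_spectrum_subset_Icc_of_isStrictlyPositive hX
  have hcont (r : ℝ) : ContinuousOn (fun x : ℝ => x ^ r) (Set.Icc a b) :=
    continuousOn_id.rpow_const fun x hx => Or.inl (ha.trans_le hx.1).ne'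
  -- These exponents make u², uv, v² equal to x^s, x^e, x^(2e-s).
  have key := Φ.nonneg_block_cfc hX.isSelfAdjoint hab hspec (hcont (s / 2)) (hcont (e - s / 2)) hc
  have hmul (r t y : ℝ) (h : r + t = y) : cfc (fun x : ℝ => x ^ r * x ^ t) X = X ^ y := by
    rw [CFC.rpow_eq_cfc_real hX.nonneg]
    refine cfc_congr fun x hx => ?_
    rw [← h, Real.rpow_add (ha.trans_le (hspec hx).1)]
  rwa [hmul _ _ s (by ring), hmul _ _ e (by ring), hmul _ _ (2 * e - s) (by ring)] at key

end BlockPositivity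

/-! ### Operator Jensen inequalities for powers -/

section OperatorJensen

variable {A₁ A₂ : Type*} [CStarAlgebra A₁] [CStarAlgebra A₂] [PartialOrder A₁] [PartialOrder A₂]
  [StarOrderedRing A₁] [StarOrderedRing A₂]

/-- If `Φ (X ^ s) ≤ Φ X ^ s` and `Φ (X ^ e) = Φ X ^ e`, then the reverse Jensen inequality holds at
the reflected exponent `2 * e - s`. -/
theorem PositiveLinearMap.rpow_map_le_of_reflect (Φ : A₁ →ₚ[ℂ] A₂) (hΦ : Φ 1 = 1) {X : A₁}
    (hX : IsStrictlyPositive X) {s e : ℝ} (hs : Φ (X ^ s) ≤ Φ X ^ s)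
    (he : Φ (X ^ e) = Φ X ^ e) :
    Φ X ^ (2 * e - s) ≤ Φ (X ^ (2 * e - s)) := by
  have hY := Φ.isStrictlyPositive_map hΦ hX
  -- With Y = `Φ X` and c = Y^(e-s), both cross terms equal Y^(2e-s) and the first term is at most
  -- Y^(2e-s), so the block inequality leaves the claim.
  have hc : IsSelfAdjoint (Φ X ^ (e - s)) := CFC.rpow_nonneg.isSelfAdjoint
  have key := Φ.nonneg_block_rpow hX s e hc
  have hle : Φ X ^ (e - s) * Φ (X ^ s) * Φ X ^ (e - s) ≤ Φ X ^ (2 * e - s) := by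
    have := star_left_conjugate_le_conjugate hs (Φ X ^ (e - s))
    rwa [hc.star_eq, ← CFC.rpow_add hY.isUnit, ← CFC.rpow_add hY.isUnit,
      show e - s + s + (e - s) = 2 * e - s by ring] at this
  rw [he, ← CFC.rpow_add hY.isUnit, ← CFC.rpow_add hY.isUnit,
    show e - s + e = 2 * e - s by ring, show e + (e - s) = 2 * e - s by ring] at key
  have h := add_le_add hle key
  have h2 := sub_nonneg.2 h
  rw [← sub_nonneg]
  convert h2 using 1
  abel

/-- Choi's inequality. -/
theorem PositiveLinearMap.inverse_map_le (Φ : A₁ →ₚ[ℂ] A₂) (hΦ : Φ 1 = 1) {X : A₁}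
    (hX : IsStrictlyPositive X) : Ring.inverse (Φ X) ≤ Φ (Ring.inverse X) := by
  have hY := Φ.isStrictlyPositive_map hΦ hX
  have := Φ.rpow_map_le_of_reflect hΦ hX (s := 1) (e := 0)
    (by rw [CFC.rpow_one X hX.nonneg, CFC.rpow_one _ hY.nonneg])
    (by rw [CFC.rpow_zero X hX.nonneg, CFC.rpow_zero _ hY.nonneg, hΦ])
  rw [CFC.inverse_eq_rpow_neg_one hX, CFC.inverse_eq_rpow_neg_one hY]
  simpa using this

theorem cfc_rpowIntegrand₀₁_eq_ringInverse {q t : ℝ} (hq : q ∈ Set.Ioo 0 1) (ht : 0 < t) {X : A₁}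
    (hX : 0 ≤ X) : cfc (Real.rpowIntegrand₀₁ q t) X =
      algebraMap ℝ A₁ (t ^ (q - 1)) - t ^ q • Ring.inverse (algebraMap ℝ A₁ t + X) := by
  have hspectrum : ∀ r ∈ spectrum ℝ X, t + r ≠ 0 := fun r hr => by
    linarith [spectrum_nonneg_of_nonneg hX hr]
  have hg : ContinuousOn (fun z : ℝ => (t + z)⁻¹) (spectrum ℝ X) :=
    ContinuousOn.inv₀ (by fun_prop) hspectrum
  have hf : ContinuousOn (fun z : ℝ => t + z) (spectrum ℝ X) := by fun_prop
  have := cfc_sub (fun _ : ℝ => t ^ (q - 1)) (fun z : ℝ => t ^ q * (t + z)⁻¹) X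
    continuousOn_const (continuousOn_const.mul hg)
  have hsa : IsSelfAdjoint X := .of_nonneg hX
  rw [Real.rpowIntegrand₀₁_eq_sub hq.2.ne ht, this, cfc_const _ X hsa, cfc_const_mul _ _ X hg,
    cfc_inv _ X hspectrum hf hsa, cfc_const_add t (fun z => z) X continuousOn_id hsa,
    cfc_id' ℝ X hsa]

open MeasureTheory in
/-- Integral representation of `X ^ q` with a measure that does not depend on the algebra. -/
theorem rpow_eq_setIntegral_cfc_rpowIntegrand₀₁ {q : ℝ} (hq : q ∈ Set.Ioo 0 1) {μ : Measure ℝ}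
    (hμ : ∀ x ∈ Set.Ici (0 : ℝ), IntegrableOn (fun t => Real.rpowIntegrand₀₁ q t x) (Set.Ioi 0) μ ∧
      x ^ q = ∫ t in Set.Ioi 0, Real.rpowIntegrand₀₁ q t x ∂μ) {X : A₁} (hX : 0 ≤ X) :
    IntegrableOn (fun t => cfc (Real.rpowIntegrand₀₁ q t) X) (Set.Ioi 0) μ ∧
      X ^ q = ∫ t in Set.Ioi 0, cfc (Real.rpowIntegrand₀₁ q t) X ∂μ := by
  have h0 : ∀ r ∈ spectrum ℝ X, 0 ≤ r := fun r hr => spectrum_nonneg_of_nonneg hX hr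
  have hcont : ContinuousOn (Function.uncurry (Real.rpowIntegrand₀₁ q))
      (Set.Ioi (0 : ℝ) ×ˢ spectrum ℝ X) :=
    Real.continuousOn_rpowIntegrand₀₁_uncurry hq _ h0
  obtain ⟨b, hb0, hb⟩ : ∃ b : ℝ, 0 ≤ b ∧ ∀ r ∈ spectrum ℝ X, r ≤ b := by
    obtain ⟨b, hb⟩ := (spectrum.isCompact (𝕜 := ℝ) X).bddAbove
    exact ⟨max 0 b, le_max_left _ _, fun r hr => (hb hr).trans (le_max_right _ _)⟩
  -- The integrand is increasing in z, so its value at the spectral bound `b` dominates it.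
  have hbound : ∀ᵐ t ∂μ.restrict (Set.Ioi 0), ∀ z ∈ spectrum ℝ X,
      ‖Real.rpowIntegrand₀₁ q t z‖ ≤ Real.rpowIntegrand₀₁ q t b := by
    filter_upwards [ae_restrict_mem measurableSet_Ioi] with t ht z hz
    rw [Real.norm_of_nonneg (Real.rpowIntegrand₀₁_nonneg hq.1 (le_of_lt ht) (h0 z hz))]
    exact Real.rpowIntegrand₀₁_monotoneOn hq (le_of_lt ht) (h0 z hz) hb0 (hb z hz)
  have hfin := (hμ b hb0).1.2
  refine ⟨integrableOn_cfc measurableSet_Ioi _ _ X hcont hbound hfin, ?_⟩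
  rw [← cfc_setIntegral measurableSet_Ioi _ _ X hcont hbound hfin, CFC.rpow_eq_cfc_real hX]
  exact cfc_congr fun r hr => (hμ r (h0 r hr)).2

/-- x^q is an integral of constants minus positive multiples of resolvents (t + x)⁻¹; Choi's
inequality for t + X handles each integrand. The same measure serves both algebras. -/
theorem PositiveLinearMap.map_rpow_le (Φ : A₁ →ₚ[ℂ] A₂) (hΦ : Φ 1 = 1) {X : A₁}
    (hX : IsStrictlyPositive X) {q : ℝ} (hq : q ∈ Set.Icc 0 1) : Φ (X ^ q) ≤ Φ X ^ q := by
  have hY := Φ.isStrictlyPositive_map hΦ hX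
  rcases hq.1.eq_or_lt with rfl | hq0
  · rw [CFC.rpow_zero X hX.nonneg, CFC.rpow_zero _ hY.nonneg, hΦ]
  rcases hq.2.eq_or_lt with rfl | hq1
  · rw [CFC.rpow_one X hX.nonneg, CFC.rpow_one _ hY.nonneg]
  have hq' : q ∈ Set.Ioo (0 : ℝ) 1 := ⟨hq0, hq1⟩
  obtain ⟨μ, hμ⟩ := Real.exists_measure_rpow_eq_integral_rpowIntegrand₀₁ hq'
  obtain ⟨hiX, hX'⟩ := rpow_eq_setIntegral_cfc_rpowIntegrand₀₁ hq' hμ hX.nonneg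
  obtain ⟨hiY, hY'⟩ := rpow_eq_setIntegral_cfc_rpowIntegrand₀₁ hq' hμ hY.nonneg
  let Φc : A₁ →L[ℝ] A₂ :=
    { toFun := Φ
      map_add' := map_add Φ
      map_smul' := Φ.map_real_smul
      cont := map_continuous Φ }
  change Φc (X ^ q) ≤ _
  rw [hX', hY', ← Φc.integral_comp_comm hiX]
  refine MeasureTheory.integral_mono_ae (Φc.integrable_comp hiX) hiY ?_
  filter_upwards [MeasureTheory.ae_restrict_mem measurableSet_Ioi] with t ht
  change Φ _ ≤ _
  rw [cfc_rpowIntegrand₀₁_eq_ringInverse hq' ht hX.nonneg,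
    cfc_rpowIntegrand₀₁_eq_ringInverse hq' ht hY.nonneg, map_sub, Φ.map_algebraMap_real hΦ,
    Φ.map_real_smul]
  have htX : IsStrictlyPositive (algebraMap ℝ A₁ t + X) := by
    have := hX.nonneg
    have ht' : (0 : ℝ) < t := ht
    grind
  have := Φ.inverse_map_le hΦ htX
  rw [map_add, Φ.map_algebraMap_real hΦ] at this
  exact sub_le_sub_left (smul_le_smul_of_nonneg_left this (Real.rpow_nonneg (le_of_lt ht) _)) _

/-- Reflects the exponent 2 - q in [0, 1] about 1. -/
theorem PositiveLinearMap.rpow_map_le_of_mem_Icc_one_two (Φ : A₁ →ₚ[ℂ] A₂) (hΦ : Φ 1 = 1) {X : A₁}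
    (hX : IsStrictlyPositive X) {q : ℝ} (hq : q ∈ Set.Icc 1 2) : Φ X ^ q ≤ Φ (X ^ q) := by
  have hY := Φ.isStrictlyPositive_map hΦ hX
  have := Φ.rpow_map_le_of_reflect hΦ hX (s := 2 - q) (e := 1)
    (Φ.map_rpow_le hΦ hX ⟨by linarith [hq.2], by linarith [hq.1]⟩)
    (by rw [CFC.rpow_one X hX.nonneg, CFC.rpow_one _ hY.nonneg])
  simpa using this

/-- Reflects the exponent -q in [0, 1] about 0. -/
theorem PositiveLinearMap.rpow_map_le_of_mem_Icc_neg_one_zero (Φ : A₁ →ₚ[ℂ] A₂) (hΦ : Φ 1 = 1)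
    {X : A₁} (hX : IsStrictlyPositive X) {q : ℝ} (hq : q ∈ Set.Icc (-1) 0) :
    Φ X ^ q ≤ Φ (X ^ q) := by
  have hY := Φ.isStrictlyPositive_map hΦ hX
  have := Φ.rpow_map_le_of_reflect hΦ hX (s := -q) (e := 0)
    (Φ.map_rpow_le hΦ hX ⟨by linarith [hq.2], by linarith [hq.1]⟩)
    (by rw [CFC.rpow_zero X hX.nonneg, CFC.rpow_zero _ hY.nonneg, hΦ])
  simpa using this

end OperatorJensen

/-! ### Scalar Kantorovich estimates -/

section ScalarEstimates

/-- Tangent line at w = 1 of w^p / p, which is concave for p < 1; dividing by p unifies the two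
signs of p. -/
theorem rpow_sub_one_div_le {p w : ℝ} (hp0 : p ≠ 0) (hp1 : p < 1) (hw : 0 < w) :
    (w ^ p - 1) / p ≤ w - 1 := by
  rcases hp0.lt_or_gt with hp | hp
  · rw [div_le_iff_of_neg hp, Real.rpow_def_of_pos hw]
    have h1 := Real.add_one_le_exp (Real.log w * p)
    have h2 := mul_le_mul_of_nonpos_right (Real.log_le_sub_one_of_pos hw) hp.le
    linarith
  · rw [div_le_iff₀ hp]
    have := rpow_one_add_le_one_add_mul_self (s := w - 1) (by linarith) hp.le hp1.le
    rw [add_sub_cancel] at this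
    linarith

theorem le_rpow_sub_one_div {p w : ℝ} (hp1 : 1 < p) (hw : 0 < w) :
    w - 1 ≤ (w ^ p - 1) / p := by
  rw [le_div_iff₀ (by linarith)]
  have := one_add_mul_self_le_rpow_one_add (s := w - 1) (by linarith) hp1.le
  rw [add_sub_cancel] at this
  linarith

theorem rpow_sub_one_div_pos {h p : ℝ} (hh : 1 < h) (hp0 : p ≠ 0) : 0 < (h ^ p - 1) / p := by
  rcases hp0.lt_or_gt with hp | hp
  · exact div_pos_of_neg_of_neg (sub_neg.2 (Real.rpow_lt_one_of_one_lt_of_neg hh hp)) hp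
  · exact div_pos (sub_pos.2 (Real.one_lt_rpow hh hp)) hp

theorem rpow_sub_self_div_pos {h p : ℝ} (hh : 1 < h) (hp1 : p ≠ 1) :
    0 < (h ^ p - h) / (p - 1) := by
  rcases hp1.lt_or_gt with hp | hp
  · have := Real.rpow_lt_rpow_of_exponent_lt hh hp
    rw [Real.rpow_one] at this
    exact div_pos_of_neg_of_neg (sub_neg.2 this) (sub_neg.2 hp)
  · have := Real.rpow_lt_rpow_of_exponent_lt hh hp
    rw [Real.rpow_one] at this
    exact div_pos (sub_pos.2 this) (sub_pos.2 hp)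

/-- Regrouped into factors that are positive for every sign of p and p - 1, so that real powers can
be split. -/
theorem kantorovich_eq {h p : ℝ} (hh : 1 < h) (hp0 : p ≠ 0) (hp1 : p ≠ 1) :
    kantorovich h p = (h ^ p - h) / (p - 1) / (h - 1) *
      ((h ^ p - 1) / p / ((h ^ p - h) / (p - 1))) ^ p := by
  have hd := (rpow_sub_self_div_pos hh hp1).ne'
  have h1 : p - 1 ≠ 0 := sub_ne_zero.2 hp1
  have h2 : h ^ p - h ≠ 0 := fun h0 => hd (by rw [h0, zero_div])
  rw [kantorovich, if_neg (by simp [hh.ne', hp0, hp1])]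
  rw [div_div, show (p - 1) / p * ((h ^ p - 1) / (h ^ p - h)) =
    (h ^ p - 1) / p / ((h ^ p - h) / (p - 1)) by field_simp]

theorem kantorovich_pos {h p : ℝ} (hh : 1 < h) : 0 < kantorovich h p := by
  by_cases hp0 : p = 0
  · simp [kantorovich, hp0]
  by_cases hp1 : p = 1
  · simp [kantorovich, hp1]
  rw [kantorovich_eq hh hp0 hp1]
  have := sub_pos.2 hh
  have := rpow_sub_self_div_pos hh hp1
  have := rpow_sub_one_div_pos hh hp0
  positivity

/-- The chord of `t ↦ t ^ (1 / p)` on `[1, h]`, pulled back along `x ↦ x ^ p`, against the identity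
and its Kantorovich multiple. The factor `ε = ±1` treats concave and convex powers together. -/
theorem chord_bounds_one {ε h p x : ℝ} (hh : 1 < h) (hp0 : p ≠ 0) (hp1 : p ≠ 1)
    (hε : ∀ w : ℝ, 0 < w → ε * ((w ^ p - 1) / p) ≤ ε * (w - 1)) (hx : x ∈ Set.Icc 1 h) :
    ε * x ≤ ε * ((h ^ p - h) / (h ^ p - 1) + (h - 1) / (h ^ p - 1) * x ^ p) ∧
      ε * ((h ^ p - h) / (h ^ p - 1) + (h - 1) / (h ^ p - 1) * x ^ p) ≤
        ε * (kantorovich h p ^ (-(1 / p)) * x) := by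
  have hx0 : 0 < x := one_pos.trans_le hx.1
  have hh0 : 0 < h := one_pos.trans hh
  have hh1 := sub_pos.2 hh
  have hg := rpow_sub_one_div_pos hh hp0
  have hd := rpow_sub_self_div_pos hh hp1
  have hp1' : p - 1 ≠ 0 := sub_ne_zero.2 hp1
  have hK := kantorovich_eq hh hp0 hp1
  obtain ⟨g, hgdef⟩ : ∃ g, g = (h ^ p - 1) / p := ⟨_, rfl⟩
  obtain ⟨d, hddef⟩ : ∃ d, d = (h ^ p - h) / (p - 1) := ⟨_, rfl⟩
  rw [← hgdef] at hg hK
  rw [← hddef] at hd hK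
  have hg1 : h ^ p - 1 = p * g := by rw [hgdef]; field_simp
  have hd1 : h ^ p - h = (p - 1) * d := by rw [hddef]; field_simp
  constructor
  -- Take the tangent of y^p / p at x, evaluated at y = 1 and y = h. The weights h - x and x - 1
  -- average 1 and h to x, so the linear terms cancel.
  · have tangent (y : ℝ) (hy : 0 < y) :
        ε * ((y ^ p - x ^ p) / p) ≤ ε * (x ^ p * (y / x - 1)) := by
      have hxp := Real.rpow_pos_of_pos hx0 p
      have := mul_le_mul_of_nonneg_left (hε (y / x) (div_pos hy hx0)) hxp.le
      rw [Real.div_rpow hy.le hx0.le] at this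
      calc _ = x ^ p * (ε * ((y ^ p / x ^ p - 1) / p)) := by field_simp
        _ ≤ _ := this
        _ = _ := by ring
    have t1 := mul_le_mul_of_nonneg_left (tangent 1 one_pos) (sub_nonneg.2 hx.2)
    have t2 := mul_le_mul_of_nonneg_left (tangent h hh0) (sub_nonneg.2 hx.1)
    rw [Real.one_rpow] at t1
    have hsum : (h - x) * (ε * (x ^ p * (1 / x - 1))) + (x - 1) * (ε * (x ^ p * (h / x - 1))) = 0 := by
      field_simp
      ring
    have hN : (h - x) * (ε * ((1 - x ^ p) / p)) + (x - 1) * (ε * ((h ^ p - x ^ p) / p)) ≤ 0 := by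
      linarith
    have hid : ε * ((h ^ p - h) / (h ^ p - 1) + (h - 1) / (h ^ p - 1) * x ^ p) - ε * x =
        -((h - x) * (ε * ((1 - x ^ p) / p)) + (x - 1) * (ε * ((h ^ p - x ^ p) / p))) / g := by
      have hpg : h ^ p = 1 + p * g := by linarith
      rw [hpg]
      have : 1 + p * g - 1 = p * g := by ring
      rw [this]
      field_simp
      ring
    rw [← sub_nonneg, hid]
    exact div_nonneg (neg_nonneg.2 hN) hg.le
  · have hu : 0 < d / (h - 1) := div_pos hd hh1
    have hv : 0 < g / d := div_pos hg hd
    have hC : kantorovich h p ^ (-(1 / p)) = (d / (h - 1)) ^ (-(1 / p)) * (d / g) := by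
      rw [hK, Real.mul_rpow hu.le (by positivity), ← Real.rpow_mul hv.le,
        show p * -(1 / p) = -1 by field_simp, Real.rpow_neg_one, inv_div]
    -- In this scaled variable the chord is (d/g)((w^p - 1)/p + 1), and K^(-1/p) x is (d/g) w; what
    -- remains is the tangent inequality at 1.
    obtain ⟨w, hw⟩ : ∃ w, w = (d / (h - 1)) ^ (-(1 / p)) * x := ⟨_, rfl⟩
    have hw0 : 0 < w := hw ▸ mul_pos (Real.rpow_pos_of_pos hu _) hx0
    have hwp : w ^ p = (h - 1) / d * x ^ p := by
      rw [hw, Real.mul_rpow (by positivity) hx0.le, ← Real.rpow_mul hu.le,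
        show -(1 / p) * p = -1 by field_simp, Real.rpow_neg_one, inv_div]
    have key := mul_le_mul_of_nonneg_left (hε w hw0) (div_pos hd hg).le
    have hxw : x ^ p = d / (h - 1) * w ^ p := by
      rw [hwp]
      field_simp
    calc _ = d / g * (ε * ((w ^ p - 1) / p)) + ε * (d / g) := by
          rw [hg1, hd1, hxw]
          field_simp
          ring
      _ ≤ d / g * (ε * (w - 1)) + ε * (d / g) := by gcongr
      _ = _ := by rw [hC, mul_right_comm, ← hw]; ring

theorem exists_chord_bounds {ε m M p : ℝ} (hm : 0 < m) (hmM : m < M) (hp0 : p ≠ 0) (hp1 : p ≠ 1)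
    (hε : ∀ w : ℝ, 0 < w → ε * ((w ^ p - 1) / p) ≤ ε * (w - 1)) :
    ∃ α β : ℝ, ∀ s ∈ Set.Icc m M, ε * s ≤ ε * (α + β * s ^ p) ∧
      ε * (α + β * s ^ p) ≤ ε * (kantorovich (M / m) p ^ (-(1 / p)) * s) := by
  have hh : 1 < M / m := (one_lt_div hm).2 hmM
  refine ⟨m * (((M / m) ^ p - M / m) / ((M / m) ^ p - 1)),
    m / m ^ p * ((M / m - 1) / ((M / m) ^ p - 1)), fun s hs => ?_⟩
  have hx : s / m ∈ Set.Icc 1 (M / m) :=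
    ⟨(one_le_div hm).2 hs.1, div_le_div_of_nonneg_right hs.2 hm.le⟩
  obtain ⟨h1, h2⟩ := chord_bounds_one hh hp0 hp1 hε hx
  have hs0 : 0 < s := hm.trans_le hs.1
  rw [Real.div_rpow hs0.le hm.le] at h1 h2
  replace h1 := mul_le_mul_of_nonneg_left h1 hm.le
  replace h2 := mul_le_mul_of_nonneg_left h2 hm.le
  have hmp := Real.rpow_pos_of_pos hm p
  obtain ⟨a, ha⟩ : ∃ a, a = ((M / m) ^ p - M / m) / ((M / m) ^ p - 1) := ⟨_, rfl⟩
  obtain ⟨b, hb⟩ : ∃ b, b = (M / m - 1) / ((M / m) ^ p - 1) := ⟨_, rfl⟩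
  rw [← ha, ← hb] at h1 h2 ⊢
  have e1 : m * (ε * (s / m)) = ε * s := by field_simp
  have e2 : m * (ε * (a + b * (s ^ p / m ^ p))) = ε * (m * a + m / m ^ p * b * s ^ p) := by
    field_simp
  have e3 (C : ℝ) : m * (ε * (C * (s / m))) = ε * (C * s) := by field_simp
  rw [e1, e2] at h1
  rw [e2, e3] at h2
  exact ⟨h1, h2⟩

end ScalarEstimates

/-! ### Kantorovich comparison for positive maps -/

section KantorovichSandwich

variable {A₁ A₂ : Type*} [CStarAlgebra A₁] [CStarAlgebra A₂] [PartialOrder A₁] [PartialOrder A₂]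
  [StarOrderedRing A₁] [StarOrderedRing A₂]

theorem isStrictlyPositive_of_spectrum_subset_Icc {m M : ℝ} (hm : 0 < m) {A : A₁}
    (hA : 0 ≤ A) (hspec : spectrum ℝ A ⊆ Set.Icc m M) : IsStrictlyPositive A :=
  (StarOrderedRing.isStrictlyPositive_iff_spectrum_pos A (.of_nonneg hA)).2
    fun _ hx => hm.trans_le (hspec hx).1

/-- A scalar inequality between `f` and an affine function of `s ^ p`, on operators. -/
theorem cfc_affine_rpow {m M p : ℝ} (hm : 0 < m) {A : A₁} (hA : 0 ≤ A)
    (hspec : spectrum ℝ A ⊆ Set.Icc m M) (ε α β C : ℝ)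
    (h : ∀ s ∈ Set.Icc m M, ε * s ≤ ε * (α + β * s ^ p) ∧ ε * (α + β * s ^ p) ≤ ε * (C * s)) :
    ε • A ≤ ε • (algebraMap ℝ A₁ α + β • A ^ p) ∧
      ε • (algebraMap ℝ A₁ α + β • A ^ p) ≤ ε • C • A := by
  have hsa : IsSelfAdjoint A := .of_nonneg hA
  have hc : ContinuousOn (fun s : ℝ => s ^ p) (spectrum ℝ A) :=
    continuousOn_id.rpow_const fun s hs => Or.inl (hm.trans_le (hspec hs).1).ne'
  have hc2 : ContinuousOn (fun s : ℝ => β * s ^ p) (spectrum ℝ A) := continuousOn_const.mul hc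
  have hc3 : ContinuousOn (fun s : ℝ => α + β * s ^ p) (spectrum ℝ A) := continuousOn_const.add hc2
  have e1 : ε • A = cfc (fun s : ℝ => ε * s) A := by
    rw [cfc_const_mul ε (fun s => s) A continuousOn_id, cfc_id' ℝ A hsa]
  have e2 : ε • (algebraMap ℝ A₁ α + β • A ^ p) = cfc (fun s : ℝ => ε * (α + β * s ^ p)) A := by
    rw [cfc_const_mul _ _ A hc3, cfc_const_add _ _ A hc2 hsa, cfc_const_mul _ _ A hc,
      CFC.rpow_eq_cfc_real hA]
  have e3 : ε • C • A = cfc (fun s : ℝ => ε * (C * s)) A := by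
    rw [cfc_const_mul ε (fun s => C * s) A (continuousOn_const.mul continuousOn_id),
      cfc_const_mul C (fun s => s) A continuousOn_id, cfc_id' ℝ A hsa]
  rw [e1, e2, e3]
  exact ⟨cfc_mono (fun s hs => (h s (hspec hs)).1) (continuousOn_const.mul continuousOn_id)
      (continuousOn_const.mul hc3),
    cfc_mono (fun s hs => (h s (hspec hs)).2) (continuousOn_const.mul hc3)
      (continuousOn_const.mul (continuousOn_const.mul continuousOn_id))⟩

theorem spectrum_rpow_subset_of_mapsTo {a b r : ℝ} {s : Set ℝ} (ha : 0 < a) {X : A₁} (hX : 0 ≤ X)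
    (h : spectrum ℝ X ⊆ Set.Icc a b) (hs : Set.MapsTo (fun x : ℝ => x ^ r) (Set.Icc a b) s) :
    spectrum ℝ (X ^ r) ⊆ s := by
  rw [CFC.rpow_eq_cfc_real hX, cfc_map_spectrum (fun x : ℝ => x ^ r) X (.of_nonneg hX)
    (continuousOn_id.rpow_const fun s hs => Or.inl (ha.trans_le (h hs).1).ne')]
  exact (Set.MapsTo.mono_left hs h).image_subset

theorem Real.mapsTo_rpow_Icc_of_nonneg {a b r : ℝ} (ha : 0 < a) (hr : 0 ≤ r) :
    Set.MapsTo (fun x : ℝ => x ^ r) (Set.Icc a b) (Set.Icc (a ^ r) (b ^ r)) := fun _ hx =>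
  ⟨Real.rpow_le_rpow ha.le hx.1 hr, Real.rpow_le_rpow (ha.le.trans hx.1) hx.2 hr⟩

theorem Real.mapsTo_rpow_Icc_of_nonpos {a b r : ℝ} (ha : 0 < a) (hr : r ≤ 0) :
    Set.MapsTo (fun x : ℝ => x ^ r) (Set.Icc a b) (Set.Icc (b ^ r) (a ^ r)) := fun _ hx =>
  ⟨Real.rpow_le_rpow_of_nonpos (ha.trans_le hx.1) hx.2 hr,
    Real.rpow_le_rpow_of_nonpos ha hx.1 hr⟩

/-- Lets the scalar bounds on [m, M] apply to the power mean itself. For p < 0 the endpoints are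
swapped twice. -/
theorem spectrum_map_rpow_rpow_subset (Φ : A₁ →ₚ[ℂ] A₂) (hΦ : Φ 1 = 1) {m M p : ℝ} (hm : 0 < m)
    (hM : 0 < M) (hp0 : p ≠ 0) {A : A₁} (hA : 0 ≤ A) (hspec : spectrum ℝ A ⊆ Set.Icc m M) :
    spectrum ℝ (Φ (A ^ p) ^ (1 / p)) ⊆ Set.Icc m M := by
  have hXsa : IsSelfAdjoint (A ^ p) := CFC.rpow_nonneg.isSelfAdjoint
  have hY : 0 ≤ Φ (A ^ p) := map_nonneg Φ CFC.rpow_nonneg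
  have hroot {x : ℝ} (hx : 0 < x) : (x ^ p) ^ (1 / p) = x := by
    rw [← Real.rpow_mul hx.le, mul_one_div_cancel hp0, Real.rpow_one]
  rcases hp0.lt_or_gt with hp | hp
  · have h1 := Φ.spectrum_map_subset_Icc hΦ hXsa
      (spectrum_rpow_subset_of_mapsTo hm hA hspec (Real.mapsTo_rpow_Icc_of_nonpos hm hp.le))
    have hMp := Real.rpow_pos_of_pos hM p
    have h2 := spectrum_rpow_subset_of_mapsTo hMp hY h1
      (Real.mapsTo_rpow_Icc_of_nonpos hMp (one_div_nonpos.2 hp.le))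
    rwa [hroot hm, hroot hM] at h2
  · have h1 := Φ.spectrum_map_subset_Icc hΦ hXsa
      (spectrum_rpow_subset_of_mapsTo hm hA hspec (Real.mapsTo_rpow_Icc_of_nonneg hm hp.le))
    have hmp := Real.rpow_pos_of_pos hm p
    have h2 := spectrum_rpow_subset_of_mapsTo hmp hY h1
      (Real.mapsTo_rpow_Icc_of_nonneg hmp (one_div_nonneg.2 hp.le))
    rwa [hroot hm, hroot hM] at h2

/-- Two-sided Kantorovich comparison of `Φ A` with the power mean `Φ (A ^ p) ^ (1 / p)`. -/
theorem PositiveLinearMap.kantorovich_bounds (Φ : A₁ →ₚ[ℂ] A₂) (hΦ : Φ 1 = 1) {ε m M p : ℝ}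
    (hm : 0 < m) (hmM : m < M) (hp0 : p ≠ 0) (hp1 : p ≠ 1)
    (hε : ∀ w : ℝ, 0 < w → ε * ((w ^ p - 1) / p) ≤ ε * (w - 1))
    {A : A₁} (hA : 0 ≤ A) (hspec : spectrum ℝ A ⊆ Set.Icc m M) :
    ε • Φ A ≤ ε • kantorovich (M / m) p ^ (-(1 / p)) • Φ (A ^ p) ^ (1 / p) ∧
      ε • Φ (A ^ p) ^ (1 / p) ≤ ε • kantorovich (M / m) p ^ (-(1 / p)) • Φ A := by
  obtain ⟨α, β, h⟩ := exists_chord_bounds hm hmM hp0 hp1 hε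
  have hA' := isStrictlyPositive_of_spectrum_subset_Icc hm hA hspec
  have hY := Φ.isStrictlyPositive_map hΦ (hA'.rpow A p)
  obtain ⟨h1, h2⟩ := cfc_affine_rpow hm hA hspec ε α β _ h
  -- The p-th power of the power mean is `Φ (A ^ p)`, so its chord coincides with the image under
  -- `Φ` of the chord for `A`; this common middle term links the two operators in both directions.
  obtain ⟨h3, h4⟩ := cfc_affine_rpow hm CFC.rpow_nonneg
    (spectrum_map_rpow_rpow_subset Φ hΦ hm (hm.trans hmM) hp0 hA hspec) ε α β _ h
  rw [CFC.rpow_rpow (Φ (A ^ p)) (1 / p) p (one_div_ne_zero hp0) hY, one_div_mul_cancel hp0,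
    CFC.rpow_one _ hY.nonneg] at h3 h4
  replace h1 := OrderHomClass.mono Φ h1
  replace h2 := OrderHomClass.mono Φ h2
  simp only [Φ.map_real_smul, map_add, Φ.map_algebraMap_real hΦ] at h1 h2
  exact ⟨h1.trans h4, h3.trans h2⟩

theorem PositiveLinearMap.kantorovich_bounds_of_lt_one (Φ : A₁ →ₚ[ℂ] A₂) (hΦ : Φ 1 = 1)
    {m M p : ℝ} (hm : 0 < m) (hmM : m < M) (hp0 : p ≠ 0) (hp1 : p < 1)
    {A : A₁} (hA : 0 ≤ A) (hspec : spectrum ℝ A ⊆ Set.Icc m M) :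
    Φ A ≤ kantorovich (M / m) p ^ (-(1 / p)) • Φ (A ^ p) ^ (1 / p) ∧
      Φ (A ^ p) ^ (1 / p) ≤ kantorovich (M / m) p ^ (-(1 / p)) • Φ A := by
  simpa using Φ.kantorovich_bounds hΦ (ε := 1) hm hmM hp0 hp1.ne
    (fun w hw => by simpa using rpow_sub_one_div_le hp0 hp1 hw) hA hspec

theorem PositiveLinearMap.kantorovich_bound_of_one_lt (Φ : A₁ →ₚ[ℂ] A₂) (hΦ : Φ 1 = 1)
    {m M p : ℝ} (hm : 0 < m) (hmM : m < M) (hp1 : 1 < p)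
    {A : A₁} (hA : 0 ≤ A) (hspec : spectrum ℝ A ⊆ Set.Icc m M) :
    kantorovich (M / m) p ^ (-(1 / p)) • Φ (A ^ p) ^ (1 / p) ≤ Φ A := by
  simpa using (Φ.kantorovich_bounds hΦ (ε := -1) hm hmM (by linarith) hp1.ne'
    (fun w hw => by linarith [le_rpow_sub_one_div hp1 hw]) hA hspec).1

theorem PositiveLinearMap.map_le_map_rpow_rpow (Φ : A₁ →ₚ[ℂ] A₂) (hΦ : Φ 1 = 1) {p : ℝ}
    (hp : 1 ≤ p) {A : A₁} (hA : IsStrictlyPositive A) : Φ A ≤ Φ (A ^ p) ^ (1 / p) := by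
  have hp0 : 0 < p := by linarith
  have := Φ.map_rpow_le hΦ (hA.rpow A p) (q := 1 / p) ⟨by positivity, (div_le_one hp0).2 hp⟩
  rwa [CFC.rpow_rpow A p (1 / p) hp0.ne' hA, mul_one_div_cancel hp0.ne',
    CFC.rpow_one A hA.nonneg] at this

/-- The conditions on p say that 1/p lies in [-1, 0) or [1, 2], where Jensen for convex powers
applies to `A ^ p`. -/
theorem PositiveLinearMap.map_rpow_rpow_le_map (Φ : A₁ →ₚ[ℂ] A₂) (hΦ : Φ 1 = 1) {p : ℝ}
    (hp : p ≤ -1 ∨ 1 / 2 ≤ p ∧ p ≤ 1) {A : A₁} (hA : IsStrictlyPositive A) :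
    Φ (A ^ p) ^ (1 / p) ≤ Φ A := by
  have hp0 : p ≠ 0 := by rintro rfl; norm_num at hp
  have := show Φ (A ^ p) ^ (1 / p) ≤ Φ ((A ^ p) ^ (1 / p)) by
    rcases hp with hp | ⟨hp, hp'⟩
    · refine Φ.rpow_map_le_of_mem_Icc_neg_one_zero hΦ (hA.rpow A p) ⟨?_, ?_⟩
      · rw [le_div_iff_of_neg (by linarith)]
        linarith
      · exact one_div_nonpos.2 (by linarith)
    · refine Φ.rpow_map_le_of_mem_Icc_one_two hΦ (hA.rpow A p) ⟨?_, ?_⟩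
      · rw [le_div_iff₀ (by linarith)]
        linarith
      · rw [div_le_iff₀ (by linarith)]
        linarith
  rwa [CFC.rpow_rpow A p (1 / p) hp0 hA, mul_one_div_cancel hp0, CFC.rpow_one A hA.nonneg] at this

theorem spectrum_add_subset_Icc {m M : ℝ} {A B : A₁} (hA : IsSelfAdjoint A) (hB : IsSelfAdjoint B)
    (hA_spec : spectrum ℝ A ⊆ Set.Icc m M) (hB_spec : spectrum ℝ B ⊆ Set.Icc m M) :
    spectrum ℝ (A + B) ⊆ Set.Icc (2 * m) (2 * M) := by
  have hlow := add_le_add ((algebraMap_le_iff_le_spectrum (a := A) hA).2 fun x hx => (hA_spec hx).1)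
    ((algebraMap_le_iff_le_spectrum (a := B) hB).2 fun x hx => (hB_spec hx).1)
  have hup := add_le_add ((le_algebraMap_iff_spectrum_le (a := A) hA).2 fun x hx => (hA_spec hx).2)
    ((le_algebraMap_iff_spectrum_le (a := B) hB).2 fun x hx => (hB_spec hx).2)
  rw [← map_add, ← two_mul] at hlow hup
  exact fun x hx => ⟨(algebraMap_le_iff_le_spectrum (hA.add hB)).1 hlow x hx,
    (le_algebraMap_iff_spectrum_le (hA.add hB)).1 hup x hx⟩

theorem CStarAlgebra.le_inv_smul_of_smul_le {C : ℝ} (hC : 0 < C) {X Y : A₁} (h : C • X ≤ Y) :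
    X ≤ C⁻¹ • Y := by
  simpa [smul_smul, hC.ne'] using smul_le_smul_of_nonneg_left h (inv_nonneg.2 hC.le)

theorem CStarAlgebra.inv_smul_le_of_le_smul {C : ℝ} (hC : 0 < C) {X Y : A₁} (h : X ≤ C • Y) :
    C⁻¹ • X ≤ Y := by
  simpa [smul_smul, hC.ne'] using smul_le_smul_of_nonneg_left h (inv_nonneg.2 hC.le)

end KantorovichSandwich

/-- Powers of operators are taken in the continuous functional calculus, `≤` is the Loewner order,
and `→ₚ[ℂ]` is the type of positive linear maps. -/
theorem theorem4p3
    {H K : Type*}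
    [NormedAddCommGroup H] [InnerProductSpace ℂ H] [CompleteSpace H]
    [NormedAddCommGroup K] [InnerProductSpace ℂ K] [CompleteSpace K]
    (m M : ℝ) (hm : 0 < m) (hmM : m < M)
    (A B : H →L[ℂ] H)
    (hA : 0 ≤ A) (hA_unit : IsUnit A) (hB : 0 ≤ B) (hB_unit : IsUnit B)
    (hA_spec : spectrum ℝ A ⊆ Set.Icc m M) (hB_spec : spectrum ℝ B ⊆ Set.Icc m M)
    (Φ : (H →L[ℂ] H) →ₚ[ℂ] (K →L[ℂ] K)) (hΦ : Φ 1 = 1) (p : ℝ) :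
    (1 ≤ p →
      kantorovich (M / m) p ^ (-(1 / p)) • (Φ (A ^ p) ^ (1 / p) + Φ (B ^ p) ^ (1 / p))
          ≤ Φ ((A + B) ^ p) ^ (1 / p) ∧
        Φ ((A + B) ^ p) ^ (1 / p)
          ≤ kantorovich (M / m) p ^ (1 / p) • (Φ (A ^ p) ^ (1 / p) + Φ (B ^ p) ^ (1 / p))) ∧
    (p ≤ -1 ∨ (1 / 2 ≤ p ∧ p ≤ 1) →
      kantorovich (M / m) p ^ (1 / p) • (Φ (A ^ p) ^ (1 / p) + Φ (B ^ p) ^ (1 / p))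
          ≤ Φ ((A + B) ^ p) ^ (1 / p) ∧
        Φ ((A + B) ^ p) ^ (1 / p)
          ≤ kantorovich (M / m) p ^ (-(1 / p)) • (Φ (A ^ p) ^ (1 / p) + Φ (B ^ p) ^ (1 / p))) ∧
    ((-1 < p ∧ p < 0) ∨ (0 < p ∧ p < 1 / 2) →
      kantorovich (M / m) p ^ (2 / p) • (Φ (A ^ p) ^ (1 / p) + Φ (B ^ p) ^ (1 / p))
          ≤ Φ ((A + B) ^ p) ^ (1 / p) ∧
        Φ ((A + B) ^ p) ^ (1 / p)
          ≤ kantorovich (M / m) p ^ (-(2 / p)) • (Φ (A ^ p) ^ (1 / p) + Φ (B ^ p) ^ (1 / p))) := by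
  have hAB : 0 ≤ A + B := add_nonneg hA hB
  have hAB_spec := spectrum_add_subset_Icc (.of_nonneg hA) (.of_nonneg hB) hA_spec hB_spec
  have hm2 : 0 < 2 * m := by linarith
  have hmM2 : 2 * m < 2 * M := by linarith
  have hratio : 2 * M / (2 * m) = M / m := mul_div_mul_left _ _ two_ne_zero
  have hK := kantorovich_pos (p := p) ((one_lt_div hm).2 hmM)
  have hA' := isStrictlyPositive_of_spectrum_subset_Icc hm hA hA_spec
  have hB' := isStrictlyPositive_of_spectrum_subset_Icc hm hB hB_spec
  have hAB' := isStrictlyPositive_of_spectrum_subset_Icc hm2 hAB hAB_spec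
  have hC : 0 < kantorovich (M / m) p ^ (-(1 / p)) := Real.rpow_pos_of_pos hK _
  have hCinv : kantorovich (M / m) p ^ (1 / p) = (kantorovich (M / m) p ^ (-(1 / p)))⁻¹ := by
    rw [Real.rpow_neg hK.le, inv_inv]
  have hC2 : kantorovich (M / m) p ^ (-(2 / p)) =
      kantorovich (M / m) p ^ (-(1 / p)) * kantorovich (M / m) p ^ (-(1 / p)) := by
    rw [← Real.rpow_add hK]
    ring_nf
  have hC2inv : kantorovich (M / m) p ^ (2 / p) = (kantorovich (M / m) p ^ (-(1 / p)))⁻¹ *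
      (kantorovich (M / m) p ^ (-(1 / p)))⁻¹ := by
    rw [← hCinv, ← Real.rpow_add hK]
    ring_nf
  have bounds (hp0 : p ≠ 0) (hp1 : p < 1) :
      Φ A + Φ B ≤ kantorovich (M / m) p ^ (-(1 / p)) •
          (Φ (A ^ p) ^ (1 / p) + Φ (B ^ p) ^ (1 / p)) ∧
        Φ (A ^ p) ^ (1 / p) + Φ (B ^ p) ^ (1 / p) ≤
          kantorovich (M / m) p ^ (-(1 / p)) • (Φ A + Φ B) ∧
        Φ A + Φ B ≤ kantorovich (M / m) p ^ (-(1 / p)) • Φ ((A + B) ^ p) ^ (1 / p) ∧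
        Φ ((A + B) ^ p) ^ (1 / p) ≤ kantorovich (M / m) p ^ (-(1 / p)) • (Φ A + Φ B) := by
    have h1 := Φ.kantorovich_bounds_of_lt_one hΦ hm hmM hp0 hp1 hA hA_spec
    have h2 := Φ.kantorovich_bounds_of_lt_one hΦ hm hmM hp0 hp1 hB hB_spec
    have h3 := Φ.kantorovich_bounds_of_lt_one hΦ hm2 hmM2 hp0 hp1 hAB hAB_spec
    rw [hratio, map_add] at h3
    simp only [smul_add] at h3 ⊢
    exact ⟨add_le_add h1.1 h2.1, add_le_add h1.2 h2.2, h3⟩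
  -- The scalar estimates exclude p = 1; there K = 1 by convention and additivity of `Φ` gives
  -- equality.
  have eq_one (hp : p = 1) : kantorovich (M / m) p = 1 ∧ Φ ((A + B) ^ p) ^ (1 / p) =
      Φ (A ^ p) ^ (1 / p) + Φ (B ^ p) ^ (1 / p) := by
    subst hp
    have hF : 0 ≤ Φ A + Φ B := add_nonneg (map_nonneg Φ hA) (map_nonneg Φ hB)
    simp [kantorovich, CFC.rpow_one, hA, hB, hAB, hF, map_nonneg Φ]
  have concave (hp1 : 1 < p) :
      kantorovich (M / m) p ^ (-(1 / p)) • (Φ (A ^ p) ^ (1 / p) + Φ (B ^ p) ^ (1 / p)) ≤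
          Φ A + Φ B ∧
        kantorovich (M / m) p ^ (-(1 / p)) • Φ ((A + B) ^ p) ^ (1 / p) ≤ Φ A + Φ B := by
    have h1 := Φ.kantorovich_bound_of_one_lt hΦ hm hmM hp1 hA hA_spec
    have h2 := Φ.kantorovich_bound_of_one_lt hΦ hm hmM hp1 hB hB_spec
    have h3 := Φ.kantorovich_bound_of_one_lt hΦ hm2 hmM2 hp1 hAB hAB_spec
    rw [hratio, map_add] at h3
    rw [smul_add]
    exact ⟨add_le_add h1 h2, h3⟩
  have jensen_ge (hp1 : 1 ≤ p) :
      Φ A + Φ B ≤ Φ (A ^ p) ^ (1 / p) + Φ (B ^ p) ^ (1 / p) ∧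
        Φ A + Φ B ≤ Φ ((A + B) ^ p) ^ (1 / p) :=
    ⟨add_le_add (Φ.map_le_map_rpow_rpow hΦ hp1 hA') (Φ.map_le_map_rpow_rpow hΦ hp1 hB'),
      by simpa using Φ.map_le_map_rpow_rpow hΦ hp1 hAB'⟩
  have jensen_le (hp : p ≤ -1 ∨ 1 / 2 ≤ p ∧ p ≤ 1) :
      Φ (A ^ p) ^ (1 / p) + Φ (B ^ p) ^ (1 / p) ≤ Φ A + Φ B ∧
        Φ ((A + B) ^ p) ^ (1 / p) ≤ Φ A + Φ B :=
    ⟨add_le_add (Φ.map_rpow_rpow_le_map hΦ hp hA') (Φ.map_rpow_rpow_le_map hΦ hp hB'),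
      by simpa using Φ.map_rpow_rpow_le_map hΦ hp hAB'⟩
  rw [hCinv, hC2, hC2inv]
  -- Only order relations remain. Away from p = 1: (i) C S ≤ F ≤ W and C W ≤ F ≤ S; (ii) S ≤ F ≤ C W
  -- and W ≤ F ≤ C S; (iii) C⁻¹ S ≤ F ≤ C W and W ≤ C F ≤ C² S.
  generalize Φ ((A + B) ^ p) ^ (1 / p) = W at *
  generalize Φ (A ^ p) ^ (1 / p) + Φ (B ^ p) ^ (1 / p) = S at *
  generalize Φ A + Φ B = F at *
  have at_one (hp : p = 1) : kantorovich (M / m) p ^ (-(1 / p)) = 1 := by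
    rw [(eq_one hp).1, Real.one_rpow]
  generalize kantorovich (M / m) p ^ (-(1 / p)) = C at *
  refine ⟨fun hp => ?_, fun hp => ?_, fun hp => ?_⟩
  · rcases hp.eq_or_lt with hp1 | hp1
    · simp [at_one hp1.symm, (eq_one hp1.symm).2]
    obtain ⟨h1, h2⟩ := concave hp1
    obtain ⟨h3, h4⟩ := jensen_ge hp
    exact ⟨h1.trans h4, CStarAlgebra.le_inv_smul_of_smul_le hC (h2.trans h3)⟩
  · by_cases hp1 : p = 1
    · simp [at_one hp1, (eq_one hp1).2]
    have hlt : p < 1 := by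
      rcases hp with hp | hp
      · linarith
      · exact lt_of_le_of_ne hp.2 hp1
    obtain ⟨h1, -, h2, -⟩ := bounds (by rintro rfl; norm_num at hp) hlt
    obtain ⟨h3, h4⟩ := jensen_le hp
    exact ⟨CStarAlgebra.inv_smul_le_of_le_smul hC (h3.trans h2), h4.trans h1⟩
  · obtain ⟨h1, h2, h3, h4⟩ := bounds (by rintro rfl; norm_num at hp)
      (by rcases hp with hp | hp <;> linarith [hp.2])
    rw [mul_smul, mul_smul]
    exact ⟨CStarAlgebra.inv_smul_le_of_le_smul hC ((CStarAlgebra.inv_smul_le_of_le_smul hC h2).trans h3),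
      h4.trans (smul_le_smul_of_nonneg_left h1 hC.le)⟩
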